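/- All matroids are finite. Let $P=p_1\cdots p_{m+r}$ and $Q=q_1\cdots q_{m+r}$ be two lattice paths from $(0,0)$ to $(m,r)$ ($m,r\ge 0$) with steps East $E=(1,0)$ and North $N=(0,1)$, such that $P$ never goes above $Q$: for every $i$, the number of North steps among $p_1,\dots,p_i$ is at most the number among $q_1,\dots,q_i$. Let $u_1<\dots<u_r$ be the positions of the North steps of $P$ and $l_1<\dots<l_r$ those of $Q$, and let $N_i=[l_i,u_i]\subseteq\{1,\dots,m+r\}$. Let $M[P,Q]$ be the transversal matroid on $\{1,\dots,m+r\}$ with presentation $(N_1,\dots,N_r)$; that is, a set $I$ is independent if and only if there is an injection $f:I\to\{1,\dots,r\}$ with $x\in N_{f(x)}$ for all $x\in I$. A lattice path matroid is a matroid isomorphic to $M[P,Q]$ for some such $P$ and $Q$. A branch-decomposition of a matroid $M$ with ground set $E$ and rank function $\rho$ is a finite tree $T$ in which every vertex has degree $1$ or $3$, together with an injective map from $E$ to the set of leaves of $T$. For an edge $e$ of $T$, let $X_e\subseteq E$ be the set of elements mapped to leaves in one of the two components of $T-e$; the width of $e$ is $\rho(X_e)+\rho(E\setminus X_e)-\rho(M)+1$.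 The width of the branch-decomposition is the maximum of the widths of the edges of $T$, and the branch-width of $M$ is the minimum width of a branch-decomposition of $M$. Write $N\preceq M$ if $N$ is isomorphic to a minor of $M$. **Theorem.** For every non-negative integer $k$, the class of lattice path matroids of branch-width at most $k$ is well-quasi-ordered by $\preceq$: the relation $\preceq$ is reflexive and transitive on this class, and for every infinite sequence $M_0,M_1,M_2,\dots$ of lattice path matroids of branch-width at most $k$ there are $i<j$ with $M_i\preceq M_j$. -/

import Mathlib

universe u

/-- `I` is a partial transversal of the family `(A i)`: its elements can be assigned
pairwise distinct indices `f x` with `x ∈ A (f x)`. -/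
def IsPartialTransversal {α ι : Type*} (A : ι → Set α) (I : Set α) : Prop :=
  ∃ f : I → ι, Function.Injective f ∧ ∀ x : I, (x : α) ∈ A (f x)

theorem IsPartialTransversal.augment {α ι : Type*} [Finite α] {A : ι → Set α} {I J : Set α}
    (hI : IsPartialTransversal A I) (hJ : IsPartialTransversal A J) (hIJ : I.ncard < J.ncard) :
    ∃ e ∈ J, e ∉ I ∧ IsPartialTransversal A (insert e I) := by
  classical
  obtain ⟨g, hg, hgA⟩ := hJ
  let agree : (I → ι) → Set α := fun f => {x | ∃ (h : x ∈ I) (h' : x ∈ J), f ⟨x, h⟩ = g ⟨x, h'⟩}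
  let S : Set ℕ := {n | ∃ f : I → ι, Function.Injective f ∧ (∀ x : I, (x : α) ∈ A (f x)) ∧
    (agree f).ncard = n}
  have hSne : S.Nonempty := by
    obtain ⟨f, hf, hfA⟩ := hI
    exact ⟨_, f, hf, hfA, rfl⟩
  have hSbd : BddAbove S := by
    refine ⟨Nat.card α, ?_⟩
    rintro n ⟨f, -, -, rfl⟩
    exact Set.ncard_le_card _
  obtain ⟨f, hf, hfA, hfS⟩ := Nat.sSup_mem hSne hSbd
  have hex : ∃ x : J, g x ∉ Set.range f := by
    by_contra! hcon
    have h1 : (Set.range g).ncard ≤ (Set.range f).ncard :=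
      Set.ncard_le_ncard (by rintro _ ⟨x, rfl⟩; exact hcon x) (Set.finite_range f)
    rw [← Set.image_univ, ← Set.image_univ, Set.ncard_image_of_injective _ hg,
      Set.ncard_image_of_injective _ hf, Set.ncard_univ, Set.ncard_univ,
      Nat.card_coe_set_eq, Nat.card_coe_set_eq] at h1
    omega
  obtain ⟨⟨x, hxJ⟩, hx⟩ := hex
  by_cases hxI : x ∈ I
  · exfalso
    let f' : I → ι := Function.update f ⟨x, hxI⟩ (g ⟨x, hxJ⟩)
    have hne : ∀ y : I, f y ≠ g ⟨x, hxJ⟩ := fun y hy => hx ⟨y, hy⟩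
    have hf' : Function.Injective f' := by
      intro a b hab
      by_cases ha : a = ⟨x, hxI⟩ <;> by_cases hb : b = ⟨x, hxI⟩
      · rw [ha, hb]
      · subst ha
        simp only [f', Function.update_self, Function.update_of_ne hb] at hab
        exact absurd hab.symm (hne b)
      · subst hb
        simp only [f', Function.update_self, Function.update_of_ne ha] at hab
        exact absurd hab (hne a)
      · simp only [f', Function.update_of_ne ha, Function.update_of_ne hb] at hab
        exact hf hab
    have hfA' : ∀ y : I, (y : α) ∈ A (f' y) := by
      intro y
      by_cases hy : y = ⟨x, hxI⟩
      · subst hy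
        simpa only [f', Function.update_self] using hgA ⟨x, hxJ⟩
      · simpa only [f', Function.update_of_ne hy] using hfA y
    have hlt : (agree f).ncard < (agree f').ncard := by
      refine Set.ncard_lt_ncard ⟨?_, fun hsub => ?_⟩ (Set.toFinite _)
      · rintro y ⟨hyI, hyJ, hy⟩
        have hyx : (⟨y, hyI⟩ : I) ≠ ⟨x, hxI⟩ := by
          intro h
          obtain rfl : y = x := congrArg Subtype.val h
          exact hne _ hy
        exact ⟨hyI, hyJ, by simpa only [f', Function.update_of_ne hyx] using hy⟩
      · obtain ⟨h1, h2, h3⟩ :=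
          hsub (show x ∈ agree f' from ⟨hxI, hxJ, by simp only [f', Function.update_self]⟩)
        exact hne _ h3
    have := le_csSup hSbd (show (agree f').ncard ∈ S from ⟨f', hf', hfA', rfl⟩)
    omega
  · refine ⟨x, hxJ, hxI, fun y => if h : (y : α) ∈ I then f ⟨y, h⟩ else g ⟨x, hxJ⟩, ?_, ?_⟩
    · rintro ⟨a, ha⟩ ⟨b, hb⟩ hab
      by_cases haI : a ∈ I <;> by_cases hbI : b ∈ I
      · simp only [haI, hbI, dite_true] at hab
        have := congrArg Subtype.val (hf hab)
        exact Subtype.ext this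
      · simp only [haI, hbI, dite_true, dite_false] at hab
        exact absurd ⟨_, hab⟩ hx
      · simp only [haI, hbI, dite_true, dite_false] at hab
        exact absurd ⟨_, hab.symm⟩ hx
      · have h1 := ha.resolve_right haI
        have h2 := hb.resolve_right hbI
        exact Subtype.ext (h1.trans h2.symm)
    · rintro ⟨a, ha⟩
      by_cases haI : a ∈ I
      · simpa only [haI, dite_true] using hfA ⟨a, haI⟩
      · obtain rfl : a = x := ha.resolve_right haI
        simpa only [haI, dite_false] using hgA ⟨a, hxJ⟩

/-- The transversal matroid with presentation `(A i)` on the finite ground set `α`: the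
independent sets are the partial transversals. -/
def transversalMatroid {α ι : Type*} [Finite α] (A : ι → Set α) : Matroid α :=
  (IndepMatroid.ofFinite (E := Set.univ) Set.finite_univ (IsPartialTransversal A)
    ⟨fun x => x.2.elim, fun x => x.2.elim, fun x => x.2.elim⟩
    (fun I J ⟨f, hf, hfA⟩ hIJ => ⟨fun x => f ⟨x, hIJ x.2⟩,
      fun x y hxy => Subtype.ext (Subtype.mk.inj (hf hxy)), fun x => hfA ⟨x, hIJ x.2⟩⟩)
    (fun _ _ hI hJ hIJ => hI.augment hJ hIJ)
    (fun I _ => Set.subset_univ I)).matroid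

@[simp] theorem transversalMatroid_ground {α ι : Type*} [Finite α] (A : ι → Set α) :
    (transversalMatroid A).E = Set.univ := rfl

@[simp] theorem transversalMatroid_indep_iff {α ι : Type*} [Finite α] {A : ι → Set α}
    {I : Set α} : (transversalMatroid A).Indep I ↔ IsPartialTransversal A I := Iff.rfl


/-- The two kinds of steps of a lattice path: East `(1, 0)` and North `(0, 1)`. -/
inductive LatticeStep where
  | E : LatticeStep
  | N : LatticeStep

open Classical in
/-- The positions of the North steps of a lattice path, given as a word of length `n`. -/
noncomputable def northSteps {n : ℕ} (w : Fin n → LatticeStep) : Finset (Fin n) :=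
  Finset.univ.filter fun i => w i = LatticeStep.N

open Classical in
/-- The number of North steps among the first `i` steps of a lattice path. -/
noncomputable def northCount {n : ℕ} (w : Fin n → LatticeStep) (i : ℕ) : ℕ :=
  ((northSteps w).filter fun j => (j : ℕ) < i).card

/-- A pair of lattice paths `P`, `Q` from `(0, 0)` to `(m, r)` such that `P` never goes
above `Q`. -/
structure LatticePathPair (m r : ℕ) where
  P : Fin (m + r) → LatticeStep
  Q : Fin (m + r) → LatticeStep
  card_P : (northSteps P).card = r
  card_Q : (northSteps Q).card = r
  le : ∀ i ≤ m + r, northCount P i ≤ northCount Q i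

/-- The interval `[l_i, u_i]`, where `l_i` is the position of the `i`-th North step of `Q`
and `u_i` is the position of the `i`-th North step of `P`. -/
noncomputable def LatticePathPair.interval {m r : ℕ} (p : LatticePathPair m r) (i : Fin r) :
    Set (Fin (m + r)) :=
  Set.Icc ((northSteps p.Q).orderEmbOfFin p.card_Q i) ((northSteps p.P).orderEmbOfFin p.card_P i)

/-- The transversal matroid `M[P, Q]`. -/
noncomputable def LatticePathPair.matroid {m r : ℕ} (p : LatticePathPair m r) :
    Matroid (Fin (m + r)) :=
  transversalMatroid p.interval

/-- Isomorphism of matroids: a bijection of the ground sets that preserves independence in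
both directions. -/
def Matroid.IsIsomorphic {α β : Type*} (M : Matroid α) (N : Matroid β) : Prop :=
  ∃ e : M.E ≃ N.E, ∀ I : Set M.E,
    M.Indep (Subtype.val '' I) ↔ N.Indep (Subtype.val '' (e '' I))

/-- A lattice path matroid is a matroid isomorphic to some `M[P, Q]`. -/
def Matroid.IsLatticePathMatroid {α : Type*} (M : Matroid α) : Prop :=
  ∃ (m r : ℕ) (p : LatticePathPair m r), M.IsIsomorphic p.matroid

/-- The minor relation between matroids on possibly different types: `N` is isomorphic to a
minor of `M`. -/
def Matroid.IsIsoMinor {α β : Type*} (N : Matroid α) (M : Matroid β) : Prop :=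
  ∃ M' : Matroid β, M' ≤m M ∧ N.IsIsomorphic M'


/-- The connectivity function `r(X) + r(E - X) - r(M)`. -/
noncomputable def Matroid.connectivity {α : Type*} (M : Matroid α) (X : Set α) : ℕ∞ :=
  M.eRk X + M.eRk (M.E \ X) - M.eRank

/-- A branch-decomposition of `M`: a finite cubic tree (every vertex has degree one or three)
some of whose leaves are labelled by the elements of `M`, distinct elements labelling
distinct leaves. -/
structure Matroid.BranchDecomposition {α : Type*} (M : Matroid α) where
  n : ℕ
  tree : SimpleGraph (Fin n)
  isTree : tree.IsTree
  cubic : ∀ v, (tree.neighborSet v).ncard = 1 ∨ (tree.neighborSet v).ncard = 3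
  label : M.E → Fin n
  label_injective : Function.Injective label
  label_leaf : ∀ e, (tree.neighborSet (label e)).ncard = 1

/-- The set of elements of `M` labelling leaves in the component of `u` after the edge `uv` of
the tree is removed. -/
def Matroid.BranchDecomposition.displayed {α : Type*} {M : Matroid α}
    (T : M.BranchDecomposition) (u v : Fin T.n) : Set α :=
  {e | ∃ h : e ∈ M.E, (T.tree.deleteEdges {s(u, v)}).Reachable u (T.label ⟨e, h⟩)}

/-- The width of a branch-decomposition: the maximum, over the edges of the tree, of
`r(X) + r(E - X) - r(M) + 1`, where `X` is a set displayed by the edge. -/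
noncomputable def Matroid.BranchDecomposition.width {α : Type*} {M : Matroid α}
    (T : M.BranchDecomposition) : ℕ∞ :=
  ⨆ (u : Fin T.n) (v : Fin T.n) (_ : T.tree.Adj u v), (M.connectivity (T.displayed u v) + 1)

/-- The branch-width of `M`: the minimum width of a branch-decomposition of `M`. -/
noncomputable def Matroid.branchWidth {α : Type*} (M : Matroid α) : ℕ∞ :=
  ⨅ T : M.BranchDecomposition, T.width

/-- The class of lattice path matroids of branch-width at most `k`, on arbitrary ground types. -/
def BoundedLatticePathMatroid (k : ℕ) : Type (u + 1) :=
  {M : Σ α : Type u, Matroid α // M.2.IsLatticePathMatroid ∧ M.2.branchWidth ≤ k}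

/-- The minor relation on the class of lattice path matroids of branch-width at most `k`. -/
def BoundedLatticePathMatroid.Minor {k : ℕ} (N M : BoundedLatticePathMatroid.{u} k) : Prop :=
  N.1.2.IsIsoMinor M.1.2

/-!
Lattice path matroids of bounded branch-width are coded by words of bounded height, and such words
are well-quasi-ordered by an operation that induces a minor.

The bases of `M[P, Q]` are the sets of North steps of the lattice paths that stay between `P` and
`Q` (`LatticePathPair.isBase_iff`). Suppose that at some position `Q` is `h` steps above `P`. The
`h` elements on either side of this position then carry a minor isomorphic to the uniform matroid of
rank `h` on `2 h` elements (`LatticePathPair.exists_uniform_window`). Every cubic tree has an edge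
that splits these elements in a balanced way, and its width grows linearly with `h`; hence
branch-width at most `k` forces `h ≤ 2 k` (`Matroid.le_of_branchWidth_le`).

Write the two paths as a word in pairs of simultaneous steps; its height is the distance from `P`
to `Q`. Suppose that between two positions of equal height `g` the height never falls below `g`. A
path that follows the North steps of `P` in between, at any distance from `P` up to `g`, stays
between `P` and `Q`. Contracting these North steps of `P` and deleting the other elements in between
therefore leaves the lattice path matroid of the word from which this excursion has been cut out
(`IsPathCode.exists_isMinor`).

It remains to see that words of height at most `K` are well-quasi-ordered by cutting out
excursions (`partiallyWellOrderedOn_boundedExcursions`). This goes by induction on `K`: the visits to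
height `0` cut a word into blocks, each a word of smaller height between an up-step and a down-step
(or a single level step), and Higman's lemma applies to the sequences of blocks.
-/

/-! ### Words of bounded height -/

/-- All partial sums `c`, `c + f a₁`, `c + f a₁ + f a₂`, … along the word `a₁ a₂ …` are
nonnegative. -/
def NonnegFrom {σ : Type*} (f : σ → ℤ) : ℤ → List σ → Prop
  | c, [] => 0 ≤ c
  | c, a :: l => 0 ≤ c ∧ NonnegFrom f (c + f a) l

section NonnegFrom

variable {σ τ : Type*} {f : σ → ℤ}

theorem NonnegFrom.start {c : ℤ} {l : List σ} (h : NonnegFrom f c l) : 0 ≤ c := by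
  cases l with
  | nil => exact h
  | cons a l => exact h.1

theorem nonnegFrom_append {c : ℤ} {x y : List σ} :
    NonnegFrom f c (x ++ y) ↔ NonnegFrom f c x ∧ NonnegFrom f (c + (x.map f).sum) y := by
  induction x generalizing c with
  | nil => simpa [NonnegFrom] using fun h : NonnegFrom f c y => h.start
  | cons a x ih => simp [NonnegFrom, ih, and_assoc, add_assoc]

theorem NonnegFrom.finish {c : ℤ} {l : List σ} (h : NonnegFrom f c l) :
    0 ≤ c + (l.map f).sum := by
  rw [← List.append_nil l, nonnegFrom_append] at h
  exact h.2

theorem NonnegFrom.mono {c d : ℤ} {l : List σ} (h : NonnegFrom f c l) (hcd : c ≤ d) :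
    NonnegFrom f d l := by
  induction l generalizing c d with
  | nil => exact le_trans h hcd
  | cons a l ih => exact ⟨h.1.trans hcd, ih h.2 (by omega)⟩

theorem nonnegFrom_map {g : τ → σ} {c : ℤ} {l : List τ} :
    NonnegFrom f c (l.map g) ↔ NonnegFrom (fun a => f (g a)) c l := by
  induction l generalizing c with
  | nil => rfl
  | cons a l ih => simp [NonnegFrom, ih]

theorem nonnegFrom_congr {g : σ → ℤ} {c : ℤ} {l : List σ} (h : ∀ a ∈ l, f a = g a) :
    NonnegFrom f c l ↔ NonnegFrom g c l := by
  induction l generalizing c with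
  | nil => rfl
  | cons a l ih =>
    simp only [List.mem_cons, forall_eq_or_imp] at h
    simp [NonnegFrom, ih h.2, h.1]

theorem nonnegFrom_iff_take {c : ℤ} {l : List σ} :
    NonnegFrom f c l ↔ ∀ t ≤ l.length, 0 ≤ c + ((l.take t).map f).sum := by
  constructor
  · intro h t _
    rw [← List.take_append_drop t l, nonnegFrom_append] at h
    exact h.1.finish
  · intro h
    induction l generalizing c with
    | nil => simpa [NonnegFrom] using h
    | cons a l ih =>
      refine ⟨by simpa using h 0 (Nat.zero_le _), ih fun t ht => ?_⟩
      simpa [add_assoc] using h (t + 1) (by simpa using ht)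

/-- A walk with steps at least `-1` that falls below `0` does so for the first time in a step from
`0` to `-1`. -/
theorem exists_first_descent (hf : ∀ a, -1 ≤ f a) {l : List σ} (h : ¬ NonnegFrom f 0 l) :
    ∃ x b z, l = x ++ b :: z ∧ NonnegFrom f 0 x ∧ (x.map f).sum = 0 ∧ f b = -1 := by
  induction l using List.reverseRecOn with
  | nil => exact absurd le_rfl h
  | append_singleton l c ih =>
    by_cases hl : NonnegFrom f 0 l
    · have h1 := hl.finish
      have h2 := hf c
      simp only [nonnegFrom_append, hl, NonnegFrom, true_and, not_and, not_le] at h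
      have h3 := h (by omega)
      exact ⟨l, c, [], rfl, hl, by omega, by omega⟩
    · obtain ⟨x, b, z, rfl, hx⟩ := ih hl
      exact ⟨x, b, z ++ [c], by simp, hx⟩

/-- An excursion of a walk: a word whose partial sums are nonnegative and which returns to `0`. -/
def IsExcursion (f : σ → ℤ) (y : List σ) : Prop :=
  NonnegFrom f 0 y ∧ (y.map f).sum = 0

/-- `u` arises from `v` by cutting out one excursion. -/
def ExcisionStep (f : σ → ℤ) (u v : List σ) : Prop :=
  ∃ x y z, IsExcursion f y ∧ v = x ++ y ++ z ∧ u = x ++ z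

/-- `u` arises from `v` by cutting out excursions one after the other. -/
def Excision (f : σ → ℤ) : List σ → List σ → Prop :=
  Relation.ReflTransGen (ExcisionStep f)

instance : IsPreorder (List σ) (Excision f) where
  refl _ := Relation.ReflTransGen.refl
  trans _ _ _ := Relation.ReflTransGen.trans

theorem Excision.context {u v : List σ} (h : Excision f u v) (x z : List σ) :
    Excision f (x ++ u ++ z) (x ++ v ++ z) := by
  refine Relation.ReflTransGen.lift (fun w => x ++ w ++ z) ?_ _ _ h
  rintro _ _ ⟨x', y, z', hy, rfl, rfl⟩
  exact ⟨x ++ x', y, z' ++ z, hy, by simp, by simp⟩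

theorem Excision.append {u v u' v' : List σ} (h : Excision f u v) (h' : Excision f u' v') :
    Excision f (u ++ u') (v ++ v') := by
  have h1 := h.context [] u'
  have h2 := h'.context v []
  simp only [List.nil_append, List.append_nil] at h1 h2
  exact h1.trans h2

theorem IsExcursion.excision_nil {y : List σ} (h : IsExcursion f y) : Excision f [] y :=
  Relation.ReflTransGen.single ⟨[], y, [], h, by simp, by simp⟩

theorem excision_flatten {l l' : List (List σ)} (h : List.SublistForall₂ (Excision f) l l')
    (hl' : ∀ y ∈ l', IsExcursion f y) : Excision f l.flatten l'.flatten := by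
  induction h with
  | @nil l' =>
    induction l' with
    | nil => exact Relation.ReflTransGen.refl
    | cons y l' ih =>
      simp only [List.mem_cons, forall_eq_or_imp] at hl'
      exact hl'.1.excision_nil.append (ih hl'.2)
  | cons h _ ih =>
    simp only [List.mem_cons, forall_eq_or_imp] at hl'
    exact h.append (ih hl'.2)
  | cons_right _ ih =>
    simp only [List.mem_cons, forall_eq_or_imp] at hl'
    exact hl'.1.excision_nil.append (ih hl'.2)

/-- The excursions whose partial sums are less than `K`. -/
def boundedExcursions (f : σ → ℤ) (K : ℕ) : Set (List σ) :=
  {w | IsExcursion f w ∧ NonnegFrom (fun a => - f a) (K - 1) w}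

theorem sum_map_neg (l : List σ) : (l.map fun a => - f a).sum = - (l.map f).sum := by
  induction l with
  | nil => simp
  | cons a l ih => simp [ih, add_comm]

/-- The words that leave height `0` only at their first and return to it only at their last
letter, without reaching height `K + 1`. -/
def excursionBlocks (f : σ → ℤ) (K : ℕ) : Set (List σ) :=
  {w | ∃ a, f a = 0 ∧ w = [a]} ∪
    ⋃ ab : σ × σ, (fun w => [ab.1] ++ w ++ [ab.2]) ''
      {w | f ab.1 = 1 ∧ f ab.2 = -1 ∧ w ∈ boundedExcursions f K}

theorem isExcursion_of_mem_excursionBlocks {K : ℕ} {w : List σ}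
    (h : w ∈ excursionBlocks f K) : IsExcursion f w := by
  rcases h with ⟨a, ha, rfl⟩ | h
  · simp [IsExcursion, NonnegFrom, ha]
  · obtain ⟨⟨a, b⟩, w, ⟨ha, hb, hw, -⟩, rfl⟩ := Set.mem_iUnion.1 h
    have h1 := hw.1.mono (show (0 : ℤ) ≤ 1 by omega)
    dsimp only at ha hb
    simp [IsExcursion, nonnegFrom_append, NonnegFrom, ha, hb, h1, hw.2]

/-- Every excursion of height at most `K` is a concatenation of blocks: cut it at its visits to
height `0`. -/
theorem exists_flatten_excursionBlocks (hf : ∀ a, |f a| ≤ 1) {K : ℕ} {w : List σ}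
    (h : w ∈ boundedExcursions f (K + 1)) :
    ∃ l : List (List σ), (∀ y ∈ l, y ∈ excursionBlocks f K) ∧ l.flatten = w := by
  induction hn : w.length using Nat.strong_induction_on generalizing w with
  | _ n ih =>
  subst hn
  cases w with
  | nil => exact ⟨[], by simp, rfl⟩
  | cons a w =>
    obtain ⟨⟨⟨-, h1⟩, h2⟩, -, h3⟩ := h
    simp only [List.map_cons, List.sum_cons] at h2
    push_cast at h3
    have ha := abs_le.1 (hf a)
    have ha0 := h1.start
    obtain ha1 | ha1 : f a = 0 ∨ f a = 1 := by omega
    · obtain ⟨l, hl, rfl⟩ := ih w.length (by simp) (w := w)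
        ⟨⟨by simpa [ha1] using h1, by omega⟩, by simpa [ha1] using h3⟩ rfl
      refine ⟨[a] :: l, ?_, rfl⟩
      simp only [List.mem_cons, forall_eq_or_imp]
      exact ⟨Or.inl ⟨a, ha1, rfl⟩, hl⟩
    · obtain ⟨x, b, z, rfl, hx, hx0, hb⟩ := exists_first_descent (f := f) (l := w)
        (fun a => (abs_le.1 (hf a)).1) (fun hw => by have := hw.finish; omega)
      simp only [List.map_append, List.map_cons, List.sum_append, List.sum_cons] at h2
      rw [nonnegFrom_append, sum_map_neg] at h3
      rw [nonnegFrom_append] at h1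
      obtain ⟨l, hl, rfl⟩ := ih z.length (by simp; omega) (w := z)
        ⟨⟨by simpa [ha1, hx0, hb] using h1.2.2, by omega⟩, by
          simpa [ha1, hx0, hb] using h3.2.2⟩ rfl
      refine ⟨([a] ++ x ++ [b]) :: l, ?_, by simp⟩
      simp only [List.mem_cons, forall_eq_or_imp]
      refine ⟨Or.inr (Set.mem_iUnion.2 ⟨(a, b), x, ⟨ha1, hb, ⟨hx, hx0⟩, ?_⟩, rfl⟩), hl⟩
      exact h3.1.mono (by omega)

/-- Words of bounded height are well-quasi-ordered by excision of excursions. Cutting a word at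
its visits to height `0` gives a sequence of blocks, each of which is a word of smaller height
between two letters, so that Higman's lemma applies. -/
theorem partiallyWellOrderedOn_boundedExcursions [Finite σ] (hf : ∀ a, |f a| ≤ 1) (K : ℕ) :
    (boundedExcursions f K).PartiallyWellOrderedOn (Excision f) := by
  induction K with
  | zero =>
    have : boundedExcursions f 0 = ∅ :=
      Set.eq_empty_of_forall_notMem fun w hw => absurd hw.2.start (by simp)
    rw [this]
    exact Set.partiallyWellOrderedOn_empty _
  | succ K ih =>
    have hB : (excursionBlocks f K).PartiallyWellOrderedOn (Excision f) := by
      refine Set.PartiallyWellOrderedOn.union ?_ ?_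
      · refine Set.Finite.partiallyWellOrderedOn ((Set.finite_range fun a : σ => [a]).subset ?_)
        rintro _ ⟨a, -, rfl⟩
        exact ⟨a, rfl⟩
      · have := Fintype.ofFinite σ
        have h := (Finset.partiallyWellOrderedOn_bUnion (r := Excision f)
          (Finset.univ : Finset (σ × σ)) (f := fun ab => (fun w => [ab.1] ++ w ++ [ab.2]) ''
            {w | f ab.1 = 1 ∧ f ab.2 = -1 ∧ w ∈ boundedExcursions f K})).2 ?_
        · simpa using h
        · intro ab _
          refine Set.PartiallyWellOrderedOn.image_of_monotone_on
            (ih.mono fun w hw => hw.2.2) ?_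
          intro u _ v _ huv
          exact huv.context _ _
    have hH := Set.PartiallyWellOrderedOn.partiallyWellOrderedOn_sublistForall₂ _ hB
    refine (hH.image_of_monotone_on (r' := Excision f) (f := List.flatten) ?_).mono ?_
    · intro u _ v hv huv
      exact excision_flatten huv fun y hy => isExcursion_of_mem_excursionBlocks (hv y hy)
    · intro w hw
      obtain ⟨l, hl, rfl⟩ := exists_flatten_excursionBlocks hf hw
      exact ⟨l, hl, rfl⟩

end NonnegFrom

/-! ### Balanced edges of trees -/

namespace SimpleGraph

variable {V : Type*} {T : SimpleGraph V} {u v x a : V}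

/-- The vertices in the component of `u` after the edge `uv` is removed. -/
def edgeSide (T : SimpleGraph V) (u v : V) : Set V :=
  {a | (T.deleteEdges {s(u, v)}).Reachable u a}

theorem Connected.exists_mem_edgeSide (hT : T.Connected) (hav : a ≠ v) :
    ∃ x, T.Adj v x ∧ a ∈ T.edgeSide x v := by
  obtain ⟨p, hp⟩ := (hT.preconnected v a).exists_isPath
  cases p with
  | nil => exact absurd rfl hav
  | @cons _ x _ h q =>
    refine ⟨x, h, (q.toDeleteEdges {s(x, v)} ?_).reachable⟩
    rintro e he rfl
    exact ((Walk.cons_isPath_iff h q).1 hp).2 (q.snd_mem_support_of_mem_edges he)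

theorem IsAcyclic.notMem_edgeSide (hT : T.IsAcyclic) (huv : T.Adj u v) : v ∉ T.edgeSide u v :=
  isBridge_iff.1 (isAcyclic_iff_forall_adj_isBridge.1 hT huv)

theorem IsAcyclic.edgeSide_subset (hT : T.IsAcyclic) (hux : T.Adj u x) (hxv : x ≠ v) :
    T.edgeSide x u ⊆ T.edgeSide u v := by
  classical
  rintro a ⟨p⟩
  have hu : u ∉ p.support := fun hu =>
    hT.notMem_edgeSide hux.symm ⟨p.takeUntil u hu⟩
  have hadj : (T.deleteEdges {s(u, v)}).Adj u x := by
    refine deleteEdges_adj.2 ⟨hux, fun h => ?_⟩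
    rcases Sym2.eq_iff.1 h with ⟨-, h⟩ | ⟨h, h'⟩
    · exact hxv h
    · exact hux.ne h'.symm
  refine hadj.reachable.trans (p.transfer _ fun e he => ?_).reachable
  have he1 := p.edges_subset_edgeSet he
  rw [edgeSet_deleteEdges] at he1 ⊢
  refine ⟨he1.1, ?_⟩
  rintro rfl
  exact hu (p.fst_mem_support_of_mem_edges he)

/-- The two sides of an edge of a forest are disjoint. -/
theorem IsAcyclic.notMem_edgeSide_symm (hT : T.IsAcyclic) (huv : T.Adj u v)
    (ha : a ∈ T.edgeSide u v) : a ∉ T.edgeSide v u := by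
  intro ha'
  have ha'' : (T.deleteEdges {s(u, v)}).Reachable v a := by
    rw [Sym2.eq_swap]
    exact ha'
  exact hT.notMem_edgeSide huv (Reachable.trans ha ha''.symm)

open Classical in
/-- In a tree of maximum degree at most three, every set of more than `4 j + 1` vertices is split
by some edge into two parts with more than `j` vertices. Otherwise each side of an edge contains at
most `j` vertices of the set or misses at most `j` of them. A smallest side of the latter kind
consists of one vertex and at most three sides of the former kind. -/
theorem IsTree.card_le_of_forall_edgeSide [Fintype V] (hT : T.IsTree)
    (hdeg : ∀ v, (T.neighborSet v).ncard ≤ 3) (w : Finset V) (j : ℕ)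
    (h : ∀ u v, T.Adj u v → (w.filter (· ∈ T.edgeSide u v)).card ≤ j ∨
      (w.filter (· ∉ T.edgeSide u v)).card ≤ j) :
    w.card ≤ 4 * j + 1 := by
  -- There are at most `3 j` vertices of `w` behind those neighbours of `u` that have at most `j`
  -- vertices of `w` behind them.
  have key : ∀ (u : V) (w' : Finset V), w' ⊆ w →
      (∀ a ∈ w', a ≠ u → ∃ x, T.Adj u x ∧ a ∈ T.edgeSide x u ∧
        (w.filter (· ∈ T.edgeSide x u)).card ≤ j) → w'.card ≤ 3 * j + 1 := by
    intro u w' hw' hcov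
    let S := (T.neighborSet u).toFinset.filter
      fun x => (w.filter (· ∈ T.edgeSide x u)).card ≤ j
    have h1 : w' ⊆ {u} ∪ S.biUnion fun x => w.filter (· ∈ T.edgeSide x u) := by
      intro a ha
      by_cases hau : a = u
      · simp [hau]
      · obtain ⟨x, hx, hax, hxj⟩ := hcov a ha hau
        refine Finset.mem_union_right _ (Finset.mem_biUnion.2 ⟨x, ?_, ?_⟩)
        · simpa [S] using ⟨hx, hxj⟩
        · simpa using ⟨hw' ha, hax⟩
    have h2 := (Finset.card_le_card h1).trans (Finset.card_union_le _ _)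
    have h3 := Finset.card_biUnion_le_card_mul S (fun x => w.filter (· ∈ T.edgeSide x u)) j
      (fun x hx => (Finset.mem_filter.1 hx).2)
    have h4 : S.card ≤ 3 := by
      refine (Finset.card_filter_le _ _).trans ?_
      rw [← Set.ncard_eq_toFinset_card']
      exact hdeg u
    have h5 := Nat.mul_le_mul_right j h4
    simp only [Finset.card_singleton] at h2
    omega
  -- The oriented edges `uv` whose side at `u` misses at most `j` vertices of `w`.
  let big : Set (V × V) :=
    {uv | T.Adj uv.1 uv.2 ∧ (w.filter (· ∉ T.edgeSide uv.1 uv.2)).card ≤ j}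
  by_cases hbig : big.Nonempty
  · obtain ⟨⟨u, v⟩, ⟨huv, hj⟩, hmin⟩ := Set.exists_min_image big
      (fun uv => (T.edgeSide uv.1 uv.2).ncard) (Set.toFinite _) hbig
    have h1 := key u (w.filter (· ∈ T.edgeSide u v)) (Finset.filter_subset _ _) ?_
    · have h2 := Finset.card_filter_add_card_filter_not (s := w) (· ∈ T.edgeSide u v)
      dsimp only at hj
      omega
    · intro a ha hau
      obtain ⟨x, hx, hax⟩ := hT.connected.exists_mem_edgeSide hau
      have hxv : x ≠ v := by
        rintro rfl
        exact hT.isAcyclic.notMem_edgeSide_symm huv (Finset.mem_filter.1 ha).2 hax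
      refine ⟨x, hx, hax, (h x u hx.symm).resolve_right fun hxb => ?_⟩
      have hlt : (T.edgeSide x u).ncard < (T.edgeSide u v).ncard := by
        refine Set.ncard_lt_ncard ⟨hT.isAcyclic.edgeSide_subset hx hxv, fun hsub => ?_⟩
          (Set.toFinite _)
        exact hT.isAcyclic.notMem_edgeSide hx.symm (hsub (Reachable.refl u))
      exact absurd (hmin (x, u) ⟨hx.symm, hxb⟩) (not_le.2 hlt)
  · obtain ⟨u⟩ := hT.connected.nonempty
    have h1 := key u w subset_rfl ?_
    · omega
    · intro a _ hau
      obtain ⟨x, hx, hax⟩ := hT.connected.exists_mem_edgeSide hau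
      exact ⟨x, hx, hax, (h x u hx.symm).resolve_right fun hxb => hbig ⟨(x, u), hx.symm, hxb⟩⟩

end SimpleGraph

/-! ### Branch-width and uniform minors -/

namespace Matroid

variable {α : Type*} {M : Matroid α} {W C : Set α} {h : ℕ}

theorem le_eRk_of_forall_isBase_union [M.Finite] (hW : W.ncard = 2 * h) (hWE : W ⊆ M.E)
    (hCE : C ⊆ M.E) (hWC : Disjoint W C)
    (hB : ∀ S ⊆ W, S.ncard = h → M.IsBase (S ∪ C)) (Y : Set α) :
    ((min (W ∩ Y).ncard h + (C ∩ Y).ncard : ℕ) : ℕ∞) ≤ M.eRk Y := by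
  have hWf := M.ground_finite.subset hWE
  have hCf := M.ground_finite.subset hCE
  obtain ⟨S, hS, hSc⟩ := Set.exists_subset_card_eq (s := W ∩ Y) (min_le_left _ h)
  obtain ⟨S', hSS', hS'W, hS'c⟩ := Set.exists_subsuperset_card_eq (n := h)
    (hS.trans Set.inter_subset_left) (hSc.trans_le (min_le_right _ _)) (by omega)
  have hI : M.Indep (S ∪ C ∩ Y) :=
    (hB S' hS'W hS'c).indep.subset (Set.union_subset_union hSS' Set.inter_subset_left)
  have hIY : S ∪ C ∩ Y ⊆ Y :=
    Set.union_subset (hS.trans Set.inter_subset_right) Set.inter_subset_right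
  have hd : Disjoint S (C ∩ Y) :=
    hWC.mono (hS.trans Set.inter_subset_left) Set.inter_subset_left
  have hfin := M.ground_finite.subset hI.subset_ground
  rw [← hSc, ← Set.ncard_union_eq hd (hfin.subset Set.subset_union_left)
    (hfin.subset Set.subset_union_right), hfin.cast_ncard_eq]
  exact hI.encard_le_eRk_of_subset hIY

/-- If contracting `C` and restricting to the `2 h`-element set `W` yields the uniform matroid of
rank `h`, then a set that contains at least `s` elements of `W` and misses at least `s` elements
of `W` has connectivity at least `s`. -/
theorem le_connectivity_of_forall_isBase_union [M.Finite] (hW : W.ncard = 2 * h)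
    (hWE : W ⊆ M.E) (hCE : C ⊆ M.E) (hWC : Disjoint W C)
    (hB : ∀ S ⊆ W, S.ncard = h → M.IsBase (S ∪ C)) (X : Set α) :
    ((min (W ∩ X).ncard (W \ X).ncard : ℕ) : ℕ∞) ≤ M.connectivity X := by
  have hWf := M.ground_finite.subset hWE
  have hCf := M.ground_finite.subset hCE
  have h1 := le_eRk_of_forall_isBase_union hW hWE hCE hWC hB X
  have h2 := le_eRk_of_forall_isBase_union hW hWE hCE hWC hB (M.E \ X)
  have e1 : W ∩ (M.E \ X) = W \ X := by
    rw [← Set.inter_sdiff_assoc, Set.inter_eq_left.2 hWE]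
  have e2 : C ∩ (M.E \ X) = C \ X := by
    rw [← Set.inter_sdiff_assoc, Set.inter_eq_left.2 hCE]
  rw [e1, e2] at h2
  obtain ⟨S, hSW, hSc⟩ := Set.exists_subset_card_eq (s := W) (n := h) (by omega)
  have hr : M.eRank = ((h + C.ncard : ℕ) : ℕ∞) := by
    rw [← (hB S hSW hSc).encard_eq_eRank, ← hSc,
      ← Set.ncard_union_eq (hWC.mono_left hSW) (hWf.subset hSW) hCf,
      ((hWf.subset hSW).union hCf).cast_ncard_eq]
  have hW2 := Set.ncard_inter_add_ncard_sdiff_eq_ncard W X hWf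
  have hC2 := Set.ncard_inter_add_ncard_sdiff_eq_ncard C X hCf
  refine ENat.le_sub_of_add_le_right (by rw [hr]; exact ENat.natCast_ne_top _) ?_
  refine le_trans ?_ (add_le_add h1 h2)
  rw [hr]
  norm_cast
  omega

/-- A matroid of branch-width at most `k` has no uniform minor of rank `h` on `2 h` elements
with `h` greater than `2 k`: an edge of a branch-decomposition that splits the elements of the minor
evenly has large width. -/
theorem le_of_branchWidth_le [M.Finite] (hW : W.ncard = 2 * h)
    (hWE : W ⊆ M.E) (hCE : C ⊆ M.E) (hWC : Disjoint W C)
    (hB : ∀ S ⊆ W, S.ncard = h → M.IsBase (S ∪ C)) {k : ℕ} (hk : M.branchWidth ≤ k) :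
    h ≤ 2 * k := by
  classical
  have hlt : M.branchWidth < (k : ℕ∞) + 1 := (ENat.lt_add_one_iff (ENat.natCast_ne_top k)).2 <| hk
  obtain ⟨T, hT⟩ := iInf_lt_iff.1 hlt
  have hTk : T.width ≤ k := Order.le_of_lt_add_one hT
  have hWf := M.ground_finite.subset hWE
  let φ : W → Fin T.n := fun e => T.label ⟨e, hWE e.2⟩
  have hφ : Function.Injective φ := fun a b hab =>
    Subtype.ext (Subtype.mk.inj (T.label_injective hab))
  have := hWf.fintype
  let w : Finset (Fin T.n) := Finset.univ.image φ
  have hwc : w.card = 2 * h := by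
    rw [Finset.card_image_of_injective _ hφ, Finset.card_univ, ← Nat.card_eq_fintype_card,
      Nat.card_coe_set_eq, hW]
  have hcard : ∀ (p : Fin T.n → Prop) [DecidablePred p] (D : Set α), D ⊆ W →
      (∀ e : W, p (φ e) ↔ (e : α) ∈ D) →
      (w.filter p).card = D.ncard := by
    intro p _ D hDW hpD
    rw [Finset.filter_image, Finset.card_image_of_injective _ hφ,
      ← Set.ncard_coe_finset, ← Set.ncard_image_of_injective _ Subtype.val_injective]
    congr 1
    ext e
    simp only [hpD, Finset.coe_filter, Finset.mem_univ, true_and, Set.mem_image,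
      Set.mem_ofPred_eq, Subtype.exists, exists_and_left, exists_prop, exists_eq_right_right]
    exact and_iff_left_of_imp fun he => hDW he
  have hfin := T.isTree.card_le_of_forall_edgeSide
    (fun v => by rcases T.cubic v with h | h <;> omega) w k ?_
  · omega
  · intro u v huv
    have hdisp : ∀ e : W, φ e ∈ T.tree.edgeSide u v ↔ (e : α) ∈ T.displayed u v := fun e =>
      ⟨fun he => ⟨hWE e.2, he⟩, fun ⟨_, he⟩ => he⟩
    rw [hcard (· ∈ T.tree.edgeSide u v) (W ∩ T.displayed u v) Set.inter_subset_left
        fun e => by rw [hdisp, Set.mem_inter_iff, and_iff_right e.2],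
      hcard (· ∉ T.tree.edgeSide u v) (W \ T.displayed u v) Set.sdiff_subset
        fun e => by rw [hdisp, Set.mem_sdiff, and_iff_right e.2]]
    have h1 := le_connectivity_of_forall_isBase_union hW hWE hCE hWC hB (T.displayed u v)
    have h2 : M.connectivity (T.displayed u v) + 1 ≤ T.width :=
      le_iSup_of_le u (le_iSup_of_le v (le_iSup_of_le huv le_rfl))
    have h3 := (h1.trans (le_self_add.trans h2)).trans hTk
    norm_cast at h3
    omega

end Matroid

/-! ### Counting below a position -/

open Classical in
/-- The number of elements of `B` among the first `t` elements of `Fin n`. -/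
noncomputable def countBelow {n : ℕ} (B : Set (Fin n)) (t : ℕ) : ℕ :=
  (Finset.univ.filter fun j : Fin n => (j : ℕ) < t ∧ j ∈ B).card

section countBelow

variable {n : ℕ} {A B S : Set (Fin n)} {a s t : ℕ}

theorem northCount_eq_countBelow (w : Fin n → LatticeStep) (t : ℕ) :
    northCount w t = countBelow {j | w j = LatticeStep.N} t := by
  classical
  rw [northCount, countBelow, ← Finset.card_image_of_injective _ Fin.val_injective]
  congr 1
  ext x
  simp only [Finset.bind_def, Finset.pure_def, northSteps, Finset.mem_filter, Finset.mem_sup,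
    Finset.mem_univ, true_and, Finset.mem_singleton, Finset.mem_image, Set.mem_ofPred_eq]
  constructor
  · rintro ⟨⟨j, hj, rfl⟩, hx⟩
    exact ⟨j, ⟨hx, hj⟩, rfl⟩
  · rintro ⟨j, ⟨hx, hj⟩, rfl⟩
    exact ⟨⟨j, hj, rfl⟩, hx⟩

theorem countBelow_zero : countBelow B 0 = 0 := by
  simp [countBelow]

open Classical in
theorem countBelow_succ (ht : t < n) :
    countBelow B (t + 1) = countBelow B t + if (⟨t, ht⟩ : Fin n) ∈ B then 1 else 0 := by
  split_ifs with h
  · rw [countBelow, countBelow, ← Finset.card_insert_of_notMem (a := (⟨t, ht⟩ : Fin n)) (by simp)]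
    congr 1
    ext j
    have hj : j = ⟨t, ht⟩ ↔ (j : ℕ) = t := Fin.ext_iff
    simp only [Finset.mem_filter, Finset.mem_univ, true_and, Finset.mem_insert,
      Nat.lt_succ_iff_lt_or_eq]
    constructor
    · rintro ⟨h1 | h1, h2⟩
      · exact Or.inr ⟨h1, h2⟩
      · exact Or.inl (hj.2 h1)
    · rintro (rfl | ⟨h1, h2⟩)
      · exact ⟨Or.inr rfl, h⟩
      · exact ⟨Or.inl h1, h2⟩
  · rw [countBelow, countBelow, add_zero]
    congr 1
    ext j
    have hj : j = ⟨t, ht⟩ ↔ (j : ℕ) = t := Fin.ext_iff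
    simp only [Finset.mem_filter, Finset.mem_univ, true_and, Nat.lt_succ_iff_lt_or_eq]
    constructor
    · rintro ⟨h1 | h1, h2⟩
      · exact ⟨h1, h2⟩
      · exact absurd (hj.2 h1 ▸ h2) h
    · rintro ⟨h1, h2⟩
      exact ⟨Or.inl h1, h2⟩

theorem countBelow_mono (h : s ≤ t) : countBelow B s ≤ countBelow B t := by
  classical
  refine Finset.card_le_card fun j hj => ?_
  simp only [Finset.mem_filter, Finset.mem_univ, true_and] at hj ⊢
  exact ⟨hj.1.trans_le h, hj.2⟩

theorem countBelow_le_add : countBelow B t ≤ countBelow B s + (t - s) := by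
  classical
  have h : (Finset.univ.filter fun j : Fin n => (j : ℕ) < t ∧ j ∈ B).image Fin.val ⊆
      (Finset.univ.filter fun j : Fin n => (j : ℕ) < s ∧ j ∈ B).image Fin.val ∪
        Finset.Ico s t := by
    intro x hx
    simp only [Finset.mem_image, Finset.mem_filter, Finset.mem_univ, true_and, Finset.mem_union,
      Finset.mem_Ico] at hx ⊢
    obtain ⟨j, ⟨h1, h2⟩, rfl⟩ := hx
    by_cases hj : (j : ℕ) < s
    · exact Or.inl ⟨j, ⟨hj, h2⟩, rfl⟩
    · exact Or.inr ⟨not_lt.1 hj, h1⟩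
  have h' := (Finset.card_le_card h).trans (Finset.card_union_le _ _)
  rwa [Finset.card_image_of_injective _ Fin.val_injective,
    Finset.card_image_of_injective _ Fin.val_injective, Nat.card_Ico] at h'

theorem countBelow_eq_ncard (h : ∀ j ∈ B, (j : ℕ) < t) : countBelow B t = B.ncard := by
  classical
  rw [countBelow, ← Set.ncard_coe_finset]
  congr 1
  ext j
  simpa using h j

theorem countBelow_eq_zero (h : ∀ j ∈ B, t ≤ (j : ℕ)) : countBelow B t = 0 := by
  classical
  rw [countBelow, Finset.card_eq_zero, Finset.filter_eq_empty_iff]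
  rintro j - ⟨h1, h2⟩
  have := h j h2
  omega

theorem countBelow_union (h : Disjoint A B) :
    countBelow (A ∪ B) t = countBelow A t + countBelow B t := by
  classical
  rw [countBelow, countBelow, countBelow, ← Finset.card_union_of_disjoint]
  · congr 1
    ext j
    simp [and_or_left]
  · rw [Finset.disjoint_left]
    intro j h1 h2
    exact Set.disjoint_left.1 h (Finset.mem_filter.1 h1).2.2 (Finset.mem_filter.1 h2).2.2

theorem countBelow_first (a : ℕ) (ht : t ≤ n) :
    countBelow {j | j ∈ B ∧ countBelow B (j + 1) ≤ a} t = min (countBelow B t) a := by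
  classical
  induction t with
  | zero => simp [countBelow_zero]
  | succ t ih =>
    have h1 := countBelow_succ (B := B) ht
    rw [countBelow_succ ht, ih (by omega)]
    simp only [Set.mem_ofPred_eq]
    split_ifs at h1 ⊢ with h2 h3 <;> first | omega | simp_all <;> omega

theorem countBelow_last (a : ℕ) (ht : t ≤ n) :
    countBelow {j | j ∈ B ∧ a < countBelow B (j + 1)} t = countBelow B t - a := by
  classical
  induction t with
  | zero => simp [countBelow_zero]
  | succ t ih =>
    have h1 := countBelow_succ (B := B) ht
    rw [countBelow_succ ht, ih (by omega)]
    simp only [Set.mem_ofPred_eq]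
    split_ifs at h1 ⊢ with h2 h3 <;> first | omega | simp_all <;> omega

theorem countBelow_coe_eq_card_orderEmbOfFin {r : ℕ} (S : Finset (Fin n)) (hS : S.card = r)
    (t : ℕ) : countBelow (S : Set (Fin n)) t =
      (Finset.univ.filter fun k : Fin r => (S.orderEmbOfFin hS k : ℕ) < t).card := by
  classical
  rw [← Finset.card_image_of_injective _ (S.orderEmbOfFin hS).injective, countBelow]
  congr 1
  ext j
  simp only [Finset.mem_filter, Finset.mem_univ, true_and, Finset.mem_coe, Finset.mem_image]
  constructor
  · rintro ⟨h1, h2⟩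
    obtain ⟨k, rfl⟩ : j ∈ Set.range (S.orderEmbOfFin hS) := by
      rwa [Finset.range_orderEmbOfFin]
    exact ⟨k, h1, rfl⟩
  · rintro ⟨k, h1, rfl⟩
    exact ⟨h1, Finset.orderEmbOfFin_mem S hS k⟩

/-- If one set has at most as many elements below every position as another set of the same
size, then each of its elements comes no earlier than the corresponding one of the other set. -/
theorem orderEmbOfFin_le_of_countBelow_le {r : ℕ} {S T : Finset (Fin n)} (hS : S.card = r)
    (hT : T.card = r) (h : ∀ t ≤ n, countBelow (S : Set (Fin n)) t ≤ countBelow (T : Set (Fin n)) t)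
    (k : Fin r) : T.orderEmbOfFin hT k ≤ S.orderEmbOfFin hS k := by
  by_contra! hlt
  have h1 := h ((S.orderEmbOfFin hS k : ℕ) + 1) (S.orderEmbOfFin hS k).2
  rw [countBelow_coe_eq_card_orderEmbOfFin S hS, countBelow_coe_eq_card_orderEmbOfFin T hT] at h1
  have h2 : Finset.Iic k ⊆ Finset.univ.filter
      fun k' : Fin r => (S.orderEmbOfFin hS k' : ℕ) < (S.orderEmbOfFin hS k : ℕ) + 1 := by
    intro k' hk'
    have := (S.orderEmbOfFin hS).monotone (Finset.mem_Iic.1 hk')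
    simpa [Nat.lt_succ_iff] using this
  have h3 : (Finset.univ.filter
      fun k' : Fin r => (T.orderEmbOfFin hT k' : ℕ) < (S.orderEmbOfFin hS k : ℕ) + 1) ⊆
      Finset.Iio k := by
    intro k' hk'
    simp only [Finset.mem_filter, Finset.mem_univ, true_and, Nat.lt_succ_iff] at hk'
    have h4 : T.orderEmbOfFin hT k' ≤ S.orderEmbOfFin hS k := hk'
    exact Finset.mem_Iio.2 ((T.orderEmbOfFin hT).lt_iff_lt.1 (h4.trans_lt hlt))
  have h5 := (Finset.card_le_card h2).trans (h1.trans (Finset.card_le_card h3))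
  simp at h5

end countBelow

/-! ### Bases of lattice path matroids -/

namespace LatticePathPair

variable {m r : ℕ} (p : LatticePathPair m r)

theorem coe_northSteps {n : ℕ} (w : Fin n → LatticeStep) :
    (northSteps w : Set (Fin n)) = {j | w j = LatticeStep.N} := by
  ext j
  simp [northSteps]

theorem northCount_eq_card {n : ℕ} (w : Fin n → LatticeStep) :
    northCount w n = (northSteps w).card := by
  rw [northCount_eq_countBelow, countBelow_eq_ncard fun j _ => j.2, ← coe_northSteps,
    Set.ncard_coe_finset]

theorem card_le_of_indep {B : Set (Fin (m + r))} (hB : p.matroid.Indep B) : B.ncard ≤ r := by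
  obtain ⟨f, hf, -⟩ := hB
  have := Nat.card_le_card_of_injective f hf
  rwa [Nat.card_coe_set_eq, Nat.card_eq_fintype_card, Fintype.card_fin] at this

theorem countBelow_of_indep {B : Set (Fin (m + r))} (hB : p.matroid.Indep B)
    (hr : B.ncard = r) (t : ℕ) :
    northCount p.P t ≤ countBelow B t ∧ countBelow B t ≤ northCount p.Q t := by
  classical
  obtain ⟨f, hf, hfB⟩ := hB
  have hbij : Function.Bijective f := by
    refine (Nat.bijective_iff_injective_and_card f).2 ⟨hf, ?_⟩
    rw [Nat.card_coe_set_eq, hr, Nat.card_eq_fintype_card, Fintype.card_fin]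
  let e := Equiv.ofBijective f hbij
  constructor
  · rw [northCount_eq_countBelow, ← coe_northSteps,
      countBelow_coe_eq_card_orderEmbOfFin _ p.card_P, countBelow]
    refine Finset.card_le_card_of_injOn (fun k => (e.symm k : Fin (m + r))) ?_ ?_
    · intro k hk
      simp only [Finset.coe_filter, Finset.mem_univ, true_and, Set.mem_ofPred_eq] at hk ⊢
      refine ⟨lt_of_le_of_lt ?_ hk, (e.symm k).2⟩
      have h := (hfB (e.symm k)).2
      rw [show f (e.symm k) = k from e.apply_symm_apply k] at h
      exact h
    · intro k _ k' _ h
      exact e.symm.injective (Subtype.ext h)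
  · rw [northCount_eq_countBelow, ← coe_northSteps,
      countBelow_coe_eq_card_orderEmbOfFin _ p.card_Q, countBelow]
    refine Finset.card_le_card_of_surjOn (fun k => (e.symm k : Fin (m + r))) ?_
    intro j hj
    simp only [Finset.coe_filter, Finset.mem_univ, true_and, Set.mem_ofPred_eq] at hj
    refine ⟨f ⟨j, hj.2⟩, ?_, ?_⟩
    · simp only [Finset.coe_filter, Finset.mem_univ, true_and, Set.mem_ofPred_eq]
      exact lt_of_le_of_lt (hfB ⟨j, hj.2⟩).1 hj.1
    · exact congrArg Subtype.val (e.symm_apply_apply ⟨j, hj.2⟩)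

theorem indep_of_countBelow {B : Set (Fin (m + r))}
    (h : ∀ t ≤ m + r, northCount p.P t ≤ countBelow B t ∧ countBelow B t ≤ northCount p.Q t) :
    p.matroid.Indep B ∧ B.ncard = r := by
  classical
  have hr : B.ncard = r := by
    have h1 := h (m + r) le_rfl
    rw [northCount_eq_card, northCount_eq_card, p.card_P, p.card_Q,
      countBelow_eq_ncard fun j _ => j.2] at h1
    omega
  refine ⟨?_, hr⟩
  have hB : B.toFinset.card = r := by rw [← Set.ncard_eq_toFinset_card', hr]
  simp only [northCount_eq_countBelow, ← coe_northSteps] at h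
  have hrange : ∀ x : B, ∃ k, B.toFinset.orderEmbOfFin hB k = x := fun x => by
    have : (x : Fin (m + r)) ∈ Set.range (B.toFinset.orderEmbOfFin hB) := by
      simp [Finset.range_orderEmbOfFin]
    exact this
  choose f hf using hrange
  refine ⟨f, fun x y hxy => Subtype.ext (by rw [← hf x, ← hf y, hxy]), fun x => ?_⟩
  rw [LatticePathPair.interval, Set.mem_Icc, ← hf x]
  constructor
  · exact orderEmbOfFin_le_of_countBelow_le hB p.card_Q
      (fun t ht => by rw [Set.coe_toFinset]; exact (h t ht).2) _
  · exact orderEmbOfFin_le_of_countBelow_le p.card_P hB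
      (fun t ht => by rw [Set.coe_toFinset]; exact (h t ht).1) _

/-- The bases of `M[P, Q]` are the sets of North steps of the lattice paths that stay between `P`
and `Q`. -/
theorem isBase_iff {B : Set (Fin (m + r))} :
    p.matroid.IsBase B ↔
      ∀ t ≤ m + r, northCount p.P t ≤ countBelow B t ∧ countBelow B t ≤ northCount p.Q t := by
  have hmax : ∀ I, p.matroid.Indep I → I.ncard = r → p.matroid.IsBase I := by
    intro I hI hr
    obtain ⟨B', hB', hIB⟩ := hI.exists_isBase_superset
    rwa [Set.eq_of_subset_of_ncard_le hIB (by rw [hr]; exact p.card_le_of_indep hB'.indep)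
      (Set.toFinite _)]
  constructor
  · intro hB t _
    obtain ⟨hP, hPr⟩ := p.indep_of_countBelow (B := {j | p.P j = LatticeStep.N})
      fun t ht => by
        rw [← northCount_eq_countBelow]
        exact ⟨le_rfl, p.le t ht⟩
    exact p.countBelow_of_indep hB.indep
      ((hB.ncard_eq_ncard_of_isBase (hmax _ hP hPr)).trans hPr) t
  · intro h
    obtain ⟨h1, h2⟩ := p.indep_of_countBelow h
    exact hmax B h1 h2

/-- Where the paths are `h` steps apart, the next `h` elements on either side of that position
span a uniform minor of rank `h`. The contracted set consists of the first North steps of `Q`, up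
to the height of `P` at this position, and of the last North steps of `P`, from the height of `Q`
on. -/
theorem exists_uniform_window {i h : ℕ} (hi : i ≤ m + r) (hpos : 0 < h)
    (hgap : northCount p.Q i = northCount p.P i + h) :
    ∃ W C : Set (Fin (m + r)), W.ncard = 2 * h ∧ Disjoint W C ∧
      ∀ S ⊆ W, S.ncard = h → p.matroid.IsBase (S ∪ C) := by
  classical
  simp only [isBase_iff, northCount_eq_countBelow] at hgap ⊢
  have hle : ∀ t ≤ m + r, countBelow {j | p.P j = LatticeStep.N} t ≤
      countBelow {j | p.Q j = LatticeStep.N} t := fun t ht => by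
    simpa only [northCount_eq_countBelow] using p.le t ht
  have hend : countBelow {j | p.P j = LatticeStep.N} (m + r) =
      countBelow {j | p.Q j = LatticeStep.N} (m + r) := by
    rw [← northCount_eq_countBelow, ← northCount_eq_countBelow, northCount_eq_card,
      northCount_eq_card, p.card_P, p.card_Q]
  generalize {j | p.P j = LatticeStep.N} = P at *
  generalize {j | p.Q j = LatticeStep.N} = Q at *
  generalize ha : countBelow P i = a at *
  have hlo : h ≤ i := by
    have := countBelow_le_add (B := Q) (s := 0) (t := i)
    rw [countBelow_zero] at this
    omega
  have hhi : i + h ≤ m + r := by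
    have h1 := countBelow_le_add (B := P) (s := i) (t := m + r)
    have h2 := countBelow_mono (B := Q) hi
    omega
  let W : Set (Fin (m + r)) := {j | i - h ≤ (j : ℕ) ∧ (j : ℕ) < i + h}
  let C₁ : Set (Fin (m + r)) := {j | j ∈ Q ∧ countBelow Q (j + 1) ≤ a}
  let C₂ : Set (Fin (m + r)) := {j | j ∈ P ∧ a + h < countBelow P (j + 1)}
  have hC₁ : ∀ j ∈ C₁, (j : ℕ) < i - h := by
    rintro j ⟨-, hj⟩
    have h1 := countBelow_le_add (B := Q) (s := j + 1) (t := i)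
    omega
  have hC₂ : ∀ j ∈ C₂, i + h ≤ (j : ℕ) := by
    rintro j ⟨-, hj⟩
    have h1 := countBelow_le_add (B := P) (s := i) (t := j + 1)
    omega
  refine ⟨W, C₁ ∪ C₂, ?_, ?_, ?_⟩
  · have hW : W = ((Finset.univ.filter fun j : Fin (m + r) =>
        i - h ≤ (j : ℕ) ∧ (j : ℕ) < i + h : Finset (Fin (m + r))) : Set (Fin (m + r))) := by
      ext j
      simp [W]
    rw [hW, Set.ncard_coe_finset, ← Finset.card_image_of_injective _ Fin.val_injective]
    have : (Finset.univ.filter fun j : Fin (m + r) =>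
        i - h ≤ (j : ℕ) ∧ (j : ℕ) < i + h).image Fin.val = Finset.Ico (i - h) (i + h) := by
      ext x
      simp only [Finset.mem_image, Finset.mem_filter, Finset.mem_univ, true_and, Finset.mem_Ico]
      exact ⟨by rintro ⟨j, hj, rfl⟩; exact hj, fun hx => ⟨⟨x, by omega⟩, hx, rfl⟩⟩
    rw [this, Nat.card_Ico]
    omega
  · rw [Set.disjoint_left]
    rintro j ⟨h1, h2⟩ (h3 | h3)
    · have := hC₁ j h3
      omega
    · have := hC₂ j h3
      omega
  · intro S hS hSc t ht
    have hd : Disjoint C₁ C₂ := Set.disjoint_left.2 fun j h1 h2 => by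
      have := hC₁ j h1
      have := hC₂ j h2
      omega
    have hd' : Disjoint S (C₁ ∪ C₂) := Set.disjoint_left.2 fun j h1 h2 => by
      have h3 := hS h1
      rcases h2 with h2 | h2
      · have := hC₁ j h2
        have := h3.1
        omega
      · have := hC₂ j h2
        have := h3.2
        omega
    rw [countBelow_union hd', countBelow_union hd, countBelow_first a ht,
      countBelow_last (a + h) ht]
    have hPQ := hle t ht
    have hS0 := countBelow_eq_zero (B := S) (t := i - h) fun j hj => (hS hj).1
    have hS1 := countBelow_eq_ncard (B := S) (t := i + h) fun j hj => (hS hj).2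
    have hS2 := countBelow_le_add (B := S) (s := t) (t := i + h)
    have hS3 := countBelow_le_add (B := S) (s := i - h) (t := t)
    have hQ1 := countBelow_le_add (B := Q) (s := t) (t := i)
    have hP1 := countBelow_le_add (B := P) (s := i) (t := t)
    rcases le_total t i with hti | hti
    · have hPt := countBelow_mono (B := P) hti
      rcases le_total t (i - h) with h1 | h1
      · have := countBelow_mono (B := S) h1
        omega
      · omega
    · have hQt := countBelow_mono (B := Q) hti
      rcases le_total (i + h) t with h1 | h1
      · have h2 := countBelow_mono (B := S) h1
        have h3 : countBelow S t = h := by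
          rw [← hSc]
          exact countBelow_eq_ncard fun j hj => (hS hj).2.trans_le h1
        omega
      · have := countBelow_mono (B := S) h1
        omega

end LatticePathPair

/-! ### Isomorphisms and minors -/

namespace Matroid

variable {ι α β γ : Type*} {M : Matroid α} {N : Matroid β} {L : Matroid γ}
  {ψ : ι → α} {χ : ι → β}

theorem isIsomorphic_of_indep_image_iff (hψ : ψ.Injective) (hM : Set.range ψ = M.E)
    (hχ : χ.Injective) (hN : Set.range χ = N.E)
    (h : ∀ I : Set ι, M.Indep (ψ '' I) ↔ N.Indep (χ '' I)) : M.IsIsomorphic N := by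
  let eM : ι ≃ M.E := (Equiv.ofInjective ψ hψ).trans (Equiv.setCongr hM)
  let eN : ι ≃ N.E := (Equiv.ofInjective χ hχ).trans (Equiv.setCongr hN)
  refine ⟨eM.symm.trans eN, fun I => ?_⟩
  obtain ⟨J, rfl⟩ : ∃ J, eM '' J = I := ⟨eM.symm '' I, eM.image_symm_image I⟩
  have h1 : Subtype.val '' (eM '' J) = ψ '' J := by
    rw [Set.image_image]
    rfl
  have h2 : Subtype.val '' ((eM.symm.trans eN) '' (eM '' J)) = χ '' J := by
    rw [Set.image_image, Set.image_image]
    simp only [Equiv.trans_apply, Equiv.symm_apply_apply]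
    rfl
  rw [h1, h2]
  exact h J

theorem IsIsomorphic.exists_indep_image_iff (h : M.IsIsomorphic N) :
    ∃ χ : M.E → β, χ.Injective ∧ Set.range χ = N.E ∧
      ∀ I : Set M.E, M.Indep (Subtype.val '' I) ↔ N.Indep (χ '' I) := by
  obtain ⟨e, he⟩ := h
  refine ⟨fun x => e x, Subtype.val_injective.comp e.injective, ?_, fun I => ?_⟩
  · rw [← Function.comp_def, Set.range_comp, e.range_eq_univ, Set.image_univ, Subtype.range_val]
  · rw [he, Set.image_image]

theorem IsIsomorphic.refl (M : Matroid α) : M.IsIsomorphic M :=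
  ⟨Equiv.refl _, fun I => by simp⟩

theorem IsIsomorphic.trans (h : M.IsIsomorphic N) (h' : N.IsIsomorphic L) :
    M.IsIsomorphic L := by
  obtain ⟨e, he⟩ := h
  obtain ⟨e', he'⟩ := h'
  refine ⟨e.trans e', fun I => ?_⟩
  rw [he, he', Equiv.coe_trans, Set.image_comp]

theorem IsBase.image_of_indep_image_iff (hψ : ψ.Injective)
    (hχ : χ.Injective) (hN : Set.range χ = N.E)
    (h : ∀ I : Set ι, M.Indep (ψ '' I) ↔ N.Indep (χ '' I)) {B : Set ι}
    (hB : M.IsBase (ψ '' B)) : N.IsBase (χ '' B) := by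
  obtain ⟨B', hB', hBB'⟩ := ((h B).1 hB.indep).exists_isBase_superset
  obtain ⟨B', rfl⟩ := Set.subset_range_iff_exists_image_eq.1 (hB'.subset_ground.trans hN.ge)
  have hsub := (Set.image_subset_image_iff hχ).1 hBB'
  have heq := hB.eq_of_subset_indep ((h B').2 hB'.indep) (Set.image_mono hsub)
  rwa [hψ.image_injective heq]

theorem isBase_image_iff_of_indep_image_iff (hψ : ψ.Injective) (hM : Set.range ψ = M.E)
    (hχ : χ.Injective) (hN : Set.range χ = N.E)
    (h : ∀ I : Set ι, M.Indep (ψ '' I) ↔ N.Indep (χ '' I)) (B : Set ι) :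
    M.IsBase (ψ '' B) ↔ N.IsBase (χ '' B) :=
  ⟨fun hB => hB.image_of_indep_image_iff hψ hχ hN h,
    fun hB => hB.image_of_indep_image_iff hχ hψ hM fun I => (h I).symm⟩

theorem Indep.image_of_isBase_image_iff (hψ : ψ.Injective) (hM : Set.range ψ = M.E)
    (h : ∀ B : Set ι, M.IsBase (ψ '' B) ↔ N.IsBase (χ '' B)) {I : Set ι}
    (hI : M.Indep (ψ '' I)) : N.Indep (χ '' I) := by
  obtain ⟨B, hB, hIB⟩ := hI.exists_isBase_superset
  obtain ⟨B, rfl⟩ := Set.subset_range_iff_exists_image_eq.1 (hB.subset_ground.trans hM.ge)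
  exact ((h B).1 hB).indep.subset (Set.image_mono ((Set.image_subset_image_iff hψ).1 hIB))

theorem isIsomorphic_of_isBase_image_iff (hψ : ψ.Injective) (hM : Set.range ψ = M.E)
    (hχ : χ.Injective) (hN : Set.range χ = N.E)
    (h : ∀ B : Set ι, M.IsBase (ψ '' B) ↔ N.IsBase (χ '' B)) : M.IsIsomorphic N :=
  isIsomorphic_of_indep_image_iff hψ hM hχ hN fun _ =>
    ⟨fun hI => hI.image_of_isBase_image_iff hψ hM h,
      fun hI => hI.image_of_isBase_image_iff hχ hN fun B => (h B).symm⟩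

/-- A minor of a matroid corresponds to a minor of every isomorphic copy. -/
theorem IsMinor.exists_isIsomorphic {M' : Matroid α} (hM' : M' ≤m M) (h : M.IsIsomorphic N) :
    ∃ N', N' ≤m N ∧ M'.IsIsomorphic N' := by
  obtain ⟨χ, hχ, hN, hind⟩ := h.exists_indep_image_iff
  obtain ⟨C, D, hC, hD, -, rfl⟩ := hM'.exists_eq_contract_delete_disjoint
  obtain ⟨I, hI⟩ := M.exists_isBasis C hC
  rw [hI.contract_eq_contract_delete, delete_delete]
  have hR : C \ I ∪ D ⊆ M.E := Set.union_subset (Set.sdiff_subset.trans hC) hD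
  generalize C \ I ∪ D = R at *
  have hIi := hI.indep
  obtain ⟨I, rfl⟩ := Set.subset_range_iff_exists_image_eq.1
    (hIi.subset_ground.trans Subtype.range_val.ge)
  obtain ⟨R, rfl⟩ := Set.subset_range_iff_exists_image_eq.1 (hR.trans Subtype.range_val.ge)
  refine ⟨N ／ (χ '' I) ＼ (χ '' R), contract_delete_isMinor _ _ _, ?_⟩
  let κ : {i : M.E // i ∉ I ∧ i ∉ R} → M.E := Subtype.val
  have hκ : κ.Injective := Subtype.val_injective
  have hrange : Set.range κ = (Set.univ \ I) \ R := by
    ext i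
    simp [κ]
  refine isIsomorphic_of_indep_image_iff (Subtype.val_injective.comp hκ) ?_ (hχ.comp hκ) ?_
    fun J => ?_
  · rw [Set.range_comp, hrange, Set.image_sdiff Subtype.val_injective,
      Set.image_sdiff Subtype.val_injective, Set.image_univ, Subtype.range_val]
    rfl
  · rw [Set.range_comp, hrange, Set.image_sdiff hχ, Set.image_sdiff hχ, Set.image_univ, hN]
    rfl
  · rw [delete_indep_iff, delete_indep_iff, hIi.contract_indep_iff,
      ((hind I).1 hIi).contract_indep_iff, Set.image_comp, Set.image_comp, ← Set.image_union,
      ← Set.image_union, hind, Set.disjoint_image_iff Subtype.val_injective,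
      Set.disjoint_image_iff Subtype.val_injective, Set.disjoint_image_iff hχ,
      Set.disjoint_image_iff hχ]

theorem IsIsoMinor.refl (M : Matroid α) : M.IsIsoMinor M :=
  ⟨M, IsMinor.refl, IsIsomorphic.refl M⟩

theorem IsIsoMinor.trans (h : L.IsIsoMinor N) (h' : N.IsIsoMinor M) : L.IsIsoMinor M := by
  obtain ⟨N', hN', hLN⟩ := h
  obtain ⟨M', hM', hNM⟩ := h'
  obtain ⟨M'', hM'', hi⟩ := hN'.exists_isIsomorphic hNM
  exact ⟨M'', hM''.trans hM', hLN.trans hi⟩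

end Matroid

/-! ### Matroids coded by words -/

/-- The height gained by a step. -/
def LatticeStep.rise : LatticeStep → ℤ
  | .E => 0
  | .N => 1

instance : Finite LatticeStep :=
  Finite.of_surjective (fun b : Bool => if b then LatticeStep.N else LatticeStep.E)
    fun s => by
      cases s
      · exact ⟨false, rfl⟩
      · exact ⟨true, rfl⟩

theorem LatticeStep.rise_nonneg_le_one (s : LatticeStep) : 0 ≤ s.rise ∧ s.rise ≤ 1 := by
  cases s <;> simp [rise]

/-- The change of the distance from the lower to the upper one of two paths in a pair of
simultaneous steps, the first of the lower and the second of the upper path. -/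
def gapChange (a : LatticeStep × LatticeStep) : ℤ :=
  a.2.rise - a.1.rise

theorem abs_gapChange_le_one (a : LatticeStep × LatticeStep) : |gapChange a| ≤ 1 := by
  have h1 := a.1.rise_nonneg_le_one
  have h2 := a.2.rise_nonneg_le_one
  rw [gapChange, abs_le]
  omega

section IsBetween

variable {α β : Type*} {B C : Set α} {s x y z : List (α × LatticeStep × LatticeStep)}

open Classical in
/-- The height gained over the lower path by the path whose North steps are the elements
of `B`. -/
noncomputable def lowerChange (B : Set α) (a : α × LatticeStep × LatticeStep) : ℤ :=
  (if a.1 ∈ B then 1 else 0) - a.2.1.rise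

open Classical in
/-- The height gained by the upper path over the path whose North steps are the elements of
`B`. -/
noncomputable def upperChange (B : Set α) (a : α × LatticeStep × LatticeStep) : ℤ :=
  a.2.2.rise - (if a.1 ∈ B then 1 else 0)

theorem lowerChange_congr {B' : Set β} {a : α × LatticeStep × LatticeStep}
    {b : β × LatticeStep × LatticeStep} (h : a.1 ∈ B ↔ b.1 ∈ B') (hab : a.2 = b.2) :
    lowerChange B a = lowerChange B' b := by
  rw [lowerChange, lowerChange, hab]
  split_ifs <;> simp_all

theorem upperChange_congr {B' : Set β} {a : α × LatticeStep × LatticeStep}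
    {b : β × LatticeStep × LatticeStep} (h : a.1 ∈ B ↔ b.1 ∈ B') (hab : a.2 = b.2) :
    upperChange B a = upperChange B' b := by
  rw [upperChange, upperChange, hab]
  split_ifs <;> simp_all

/-- The word `s` lists elements together with the simultaneous steps of a lower and an upper path.
The path whose North steps are the elements of `B` stays between the two paths and has the same end
as both. -/
def IsBetween (B : Set α) (s : List (α × LatticeStep × LatticeStep)) : Prop :=
  IsExcursion (lowerChange B) s ∧ IsExcursion (upperChange B) s

theorem IsExcursion.add {σ : Type*} {f g : σ → ℤ} {l : List σ} (hf : IsExcursion f l)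
    (hg : IsExcursion g l) : IsExcursion (fun a => f a + g a) l := by
  constructor
  · have h : ∀ {c d : ℤ} {l : List σ}, NonnegFrom f c l → NonnegFrom g d l →
        NonnegFrom (fun a => f a + g a) (c + d) l := by
      intro c d l
      induction l generalizing c d with
      | nil => exact fun h1 h2 => add_nonneg h1 h2
      | cons a l ih =>
        intro h1 h2
        refine ⟨add_nonneg h1.1 h2.1, ?_⟩
        rw [add_add_add_comm]
        exact ih h1.2 h2.2
    exact h hf.1 hg.1
  · rw [List.sum_map_add, hf.2, hg.2, add_zero]

theorem isExcursion_map {σ τ : Type*} {f : σ → ℤ} {g : τ → σ} {l : List τ} :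
    IsExcursion f (l.map g) ↔ IsExcursion (fun a => f (g a)) l := by
  rw [IsExcursion, IsExcursion, nonnegFrom_map, List.map_map, Function.comp_def]

theorem isExcursion_congr {σ : Type*} {f g : σ → ℤ} {l : List σ} (h : ∀ a ∈ l, f a = g a) :
    IsExcursion f l ↔ IsExcursion g l := by
  rw [IsExcursion, IsExcursion, nonnegFrom_congr h, List.map_congr_left h]

theorem isExcursion_append_append_iff {σ : Type*} {f : σ → ℤ} {x y z : List σ}
    (hy : IsExcursion f y) : IsExcursion f (x ++ y ++ z) ↔ IsExcursion f (x ++ z) := by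
  simp only [IsExcursion, nonnegFrom_append, List.map_append, List.sum_append, hy.2, add_zero,
    zero_add]
  refine and_congr_left fun _ => ⟨fun h => ⟨h.1.1, h.2⟩, fun h => ⟨⟨h.1, ?_⟩, h.2⟩⟩
  exact hy.1.mono (by simpa using h.1.finish)

theorem IsBetween.isExcursion_gapChange (h : IsBetween B s) :
    IsExcursion gapChange (s.map Prod.snd) := by
  rw [isExcursion_map]
  refine (isExcursion_congr fun a _ => ?_).1 (h.1.add h.2)
  simp only [lowerChange, upperChange, gapChange]
  ring

theorem isBetween_image_map_iff {ψ : β → α} (hψ : ψ.Injective) {B : Set β}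
    {s : List (β × LatticeStep × LatticeStep)} :
    IsBetween (ψ '' B) (s.map (Prod.map ψ id)) ↔ IsBetween B s := by
  simp only [IsBetween, isExcursion_map]
  refine and_congr (isExcursion_congr fun a _ => ?_) (isExcursion_congr fun a _ => ?_)
  · exact lowerChange_congr hψ.mem_set_image rfl
  · exact upperChange_congr hψ.mem_set_image rfl

/-- The North steps of the lower path. -/
def lowerNorths (s : List (α × LatticeStep × LatticeStep)) : Set α :=
  {e | ∃ a ∈ s, a.1 = e ∧ a.2.1 = LatticeStep.N}

theorem lowerChange_eq_zero {a : α × LatticeStep × LatticeStep}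
    (h : a.1 ∈ B ↔ a.2.1 = LatticeStep.N) : lowerChange B a = 0 := by
  obtain ⟨e, p, q⟩ := a
  cases p <;> simp_all [lowerChange, LatticeStep.rise]

theorem isBetween_of_forall_mem_iff (hs : IsExcursion gapChange (s.map Prod.snd))
    (h : ∀ a ∈ s, a.1 ∈ B ↔ a.2.1 = LatticeStep.N) : IsBetween B s := by
  have hl : ∀ a ∈ s, lowerChange B a = 0 := fun a ha => lowerChange_eq_zero (h a ha)
  constructor
  · rw [isExcursion_congr hl]
    have : ∀ l : List (α × LatticeStep × LatticeStep), IsExcursion (fun _ => 0) l := fun l =>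
      ⟨nonnegFrom_iff_take.2 fun t _ => by simp, by simp⟩
    exact this s
  · rw [isExcursion_map] at hs
    refine (isExcursion_congr fun a ha => ?_).1 hs
    have h1 := hl a ha
    simp only [lowerChange] at h1
    simp only [gapChange, upperChange]
    omega

theorem mem_lowerNorths_iff (hs : (s.map Prod.fst).Nodup) {a : α × LatticeStep × LatticeStep}
    (ha : a ∈ s) : a.1 ∈ lowerNorths s ↔ a.2.1 = LatticeStep.N := by
  constructor
  · rintro ⟨b, hb, h1, h2⟩
    rwa [List.inj_on_of_nodup_map hs hb ha h1] at h2
  · intro h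
    exact ⟨a, ha, rfl, h⟩

/-- A path that follows the lower path on a factor `y` whose gap is an excursion stays between the
two paths if and only if it does so after `y` is cut out. -/
theorem isBetween_append_append_iff (hs : ((x ++ y ++ z).map Prod.fst).Nodup)
    (hy : IsExcursion gapChange (y.map Prod.snd)) (hB : ∀ a ∈ y, a.1 ∉ B) :
    IsBetween (B ∪ lowerNorths y) (x ++ y ++ z) ↔ IsBetween B (x ++ z) := by
  have hyn : (y.map Prod.fst).Nodup := by
    simp only [List.map_append] at hs
    exact hs.of_append_left.of_append_right
  have hyb : IsBetween (B ∪ lowerNorths y) y :=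
    isBetween_of_forall_mem_iff hy fun a ha => by
      rw [Set.mem_union, or_iff_right (hB a ha), mem_lowerNorths_iff hyn ha]
  have hxz : ∀ a ∈ x ++ z, (a.1 ∈ B ∪ lowerNorths y ↔ a.1 ∈ B) := by
    intro a ha
    refine or_iff_left ?_
    rintro ⟨b, hb, hba, -⟩
    have hperm : (x ++ y ++ z).Perm (y ++ (x ++ z)) := by
      rw [← List.append_assoc]
      exact List.perm_append_comm.append_right z
    have hs' := (hperm.map Prod.fst).nodup_iff.1 hs
    rw [List.map_append] at hs'
    exact List.disjoint_of_nodup_append hs' (List.mem_map_of_mem hb)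
      (hba ▸ List.mem_map_of_mem ha)
  rw [IsBetween, isExcursion_append_append_iff hyb.1, isExcursion_append_append_iff hyb.2]
  refine and_congr (isExcursion_congr fun a ha => ?_) (isExcursion_congr fun a ha => ?_)
  · exact lowerChange_congr (hxz a ha) rfl
  · exact upperChange_congr (hxz a ha) rfl

end IsBetween

/-- The word `s` enumerates the ground set of `M` and labels its elements with the simultaneous
steps of two lattice paths, such that the bases of `M` are the sets of North steps of the paths
between these two. -/
structure IsPathCode {α : Type*} (M : Matroid α) (s : List (α × LatticeStep × LatticeStep)) :
    Prop where
  nodup : (s.map Prod.fst).Nodup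
  mem_ground : ∀ e, e ∈ M.E ↔ ∃ a ∈ s, a.1 = e
  isBase_iff : ∀ B ⊆ M.E, M.IsBase B ↔ IsBetween B s

namespace IsPathCode

variable {α β : Type*} {M : Matroid α} {N : Matroid β}
  {s x y z : List (α × LatticeStep × LatticeStep)}

theorem isExcursion_gapChange (h : IsPathCode M s) : IsExcursion gapChange (s.map Prod.snd) := by
  obtain ⟨B, hB⟩ := M.exists_isBase
  exact ((h.isBase_iff B hB.subset_ground).1 hB).isExcursion_gapChange

open scoped Matroid in
/-- Cutting out of the coding word a factor along which the gap is an excursion amounts to taking a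
minor: contract the North steps of the lower path in this factor and delete its other elements. -/
theorem exists_isMinor (h : IsPathCode M (x ++ y ++ z))
    (hy : IsExcursion gapChange (y.map Prod.snd)) :
    ∃ M', M' ≤m M ∧ IsPathCode M' (x ++ z) := by
  let Y : Set α := {e | ∃ a ∈ y, a.1 = e}
  let C := lowerNorths y
  have hCY : C ⊆ Y := fun e ⟨a, ha, hae, _⟩ => ⟨a, ha, hae⟩
  let D := Y \ C
  have hCD : C ∪ D = Y := Set.union_sdiff_cancel hCY
  have hYE : Y ⊆ M.E := fun e ⟨a, ha, hae⟩ => (h.mem_ground e).2 ⟨a, by simp [ha], hae⟩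
  have hxz : ∀ e, (∃ a ∈ x ++ z, a.1 = e) ↔ e ∈ M.E ∧ e ∉ Y := by
    intro e
    have hperm : (x ++ y ++ z).Perm (y ++ (x ++ z)) := by
      rw [← List.append_assoc]
      exact List.perm_append_comm.append_right z
    have hs' := (hperm.map Prod.fst).nodup_iff.1 h.nodup
    rw [List.map_append] at hs'
    constructor
    · rintro ⟨a, ha, rfl⟩
      refine ⟨(h.mem_ground _).2 ⟨a, hperm.mem_iff.2 (List.mem_append_right _ ha), rfl⟩, ?_⟩
      rintro ⟨b, hb, hba⟩
      exact List.disjoint_of_nodup_append hs' (List.mem_map_of_mem hb)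
        (hba ▸ List.mem_map_of_mem ha)
    · rintro ⟨he, heY⟩
      obtain ⟨a, ha, rfl⟩ := (h.mem_ground e).1 he
      rcases List.mem_append.1 (hperm.mem_iff.1 ha) with ha | ha
      · exact absurd ⟨a, ha, rfl⟩ heY
      · exact ⟨a, ha, rfl⟩
  -- The lower path itself is a base; its elements in the factor are those of `C`.
  have hB₀E : lowerNorths (x ++ y ++ z) ⊆ M.E := fun e ⟨a, ha, hae, _⟩ =>
    (h.mem_ground e).2 ⟨a, ha, hae⟩
  have hB₀ : M.IsBase (lowerNorths (x ++ y ++ z)) := (h.isBase_iff _ hB₀E).2 <|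
    isBetween_of_forall_mem_iff h.isExcursion_gapChange fun a ha => mem_lowerNorths_iff h.nodup ha
  have hCB₀ : C ⊆ lowerNorths (x ++ y ++ z) := fun e ⟨a, ha, hae⟩ => ⟨a, by simp [ha], hae⟩
  have hC : M.Indep C := hB₀.indep.subset hCB₀
  have hD : (M ／ C).Coindep D := by
    rw [Matroid.coindep_iff_exists
      (by rw [Matroid.contract_ground]; exact Set.sdiff_subset_sdiff_left hYE)]
    refine ⟨lowerNorths (x ++ y ++ z) \ C, ?_, ?_⟩
    · rw [hC.contract_isBase_iff, Set.sdiff_union_of_subset hCB₀]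
      exact ⟨hB₀, Set.disjoint_sdiff_left⟩
    · rintro e ⟨he, heC⟩
      refine ⟨⟨hB₀E he, heC⟩, ?_⟩
      rintro ⟨⟨a, ha, rfl⟩, -⟩
      exact heC ⟨a, ha, rfl, (mem_lowerNorths_iff h.nodup (by simp [ha])).1 he⟩
  have hground : (M ／ C ＼ D).E = M.E \ Y := by
    rw [Matroid.delete_ground, Matroid.contract_ground, Set.sdiff_sdiff, hCD]
  refine ⟨M ／ C ＼ D, Matroid.contract_delete_isMinor _ _ _, ?_, ?_, ?_⟩
  · refine h.nodup.sublist (List.Sublist.map _ ?_)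
    exact (List.sublist_append_left x y).append_right z
  · intro e
    rw [hground, hxz]
    rfl
  · intro B hB
    rw [hground, Set.subset_sdiff] at hB
    rw [hD.delete_isBase_iff, hC.contract_isBase_iff,
      and_iff_left (hB.2.mono_right Set.sdiff_subset), and_iff_left (hB.2.mono_right hCY),
      h.isBase_iff _ (Set.union_subset hB.1 (hCY.trans hYE)),
      isBetween_append_append_iff h.nodup hy]
    exact fun a ha haB => Set.disjoint_left.1 hB.2 haB ⟨a, ha, rfl⟩

theorem exists_isMinor_of_excision (h : IsPathCode M s) {w : List (LatticeStep × LatticeStep)}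
    (hw : Excision gapChange w (s.map Prod.snd)) :
    ∃ M' s', M' ≤m M ∧ IsPathCode M' s' ∧ s'.map Prod.snd = w := by
  induction hw using Relation.ReflTransGen.head_induction_on with
  | refl => exact ⟨M, s, Matroid.IsMinor.refl, h, rfl⟩
  | head hstep _ ih =>
    obtain ⟨M', s', hM', hs', hw'⟩ := ih
    obtain ⟨x, y, z, hy, hv, rfl⟩ := hstep
    rw [hv, List.map_eq_append_iff] at hw'
    obtain ⟨xy, z, rfl, hxy, rfl⟩ := hw'
    obtain ⟨x, y, rfl, rfl, rfl⟩ := List.map_eq_append_iff.1 hxy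
    obtain ⟨M'', hM'', hs''⟩ := hs'.exists_isMinor hy
    exact ⟨M'', x ++ z, hM''.trans hM', hs'', by simp⟩

theorem exists_isBase_image_iff (h : IsPathCode M s) {w : List (LatticeStep × LatticeStep)}
    (hw : s.map Prod.snd = w) :
    ∃ ψ : Fin w.length → α, ψ.Injective ∧ Set.range ψ = M.E ∧ ∀ B, M.IsBase (ψ '' B) ↔
      IsBetween B (List.ofFn fun i : Fin w.length => (i, w.get i)) := by
  subst hw
  let ψ : Fin (s.map Prod.snd).length → α := fun i => (s.get (i.cast (by simp))).1
  have hψ : ψ.Injective := by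
    intro i j hij
    have h1 := h.nodup
    rw [List.nodup_iff_injective_get] at h1
    have h2 := @h1 (i.cast (by simp)) (j.cast (by simp)) (by simpa [ψ] using hij)
    simpa [Fin.ext_iff] using h2
  have hrange : Set.range ψ = M.E := by
    ext e
    rw [h.mem_ground]
    constructor
    · rintro ⟨i, rfl⟩
      exact ⟨_, List.get_mem _ _, rfl⟩
    · rintro ⟨a, ha, rfl⟩
      obtain ⟨i, rfl⟩ := List.get_of_mem ha
      exact ⟨i.cast (by simp), rfl⟩
  have hs : s = (List.ofFn fun i : Fin (s.map Prod.snd).length =>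
      (i, (s.map Prod.snd).get i)).map (Prod.map ψ id) := by
    refine List.ext_getElem (by simp) fun i h1 h2 => ?_
    simp [ψ]
  refine ⟨ψ, hψ, hrange, fun B => ?_⟩
  have hB := isBetween_image_map_iff hψ (B := B)
    (s := List.ofFn fun i : Fin (s.map Prod.snd).length => (i, (s.map Prod.snd).get i))
  rw [← hs] at hB
  rw [h.isBase_iff _ ((Set.image_subset_range _ _).trans hrange.le), hB]

theorem isIsomorphic {s' : List (β × LatticeStep × LatticeStep)} (h : IsPathCode M s)
    (h' : IsPathCode N s') (hs : s.map Prod.snd = s'.map Prod.snd) : M.IsIsomorphic N := by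
  obtain ⟨ψ, hψ, hM, hB⟩ := h.exists_isBase_image_iff hs
  obtain ⟨χ, hχ, hN, hB'⟩ := h'.exists_isBase_image_iff rfl
  exact Matroid.isIsomorphic_of_isBase_image_iff hψ hM hχ hN fun B => (hB B).trans (hB' B).symm

end IsPathCode

/-! ### Lattice path matroids of bounded branch-width -/

theorem nonnegFrom_ofFn {σ : Type*} {f : σ → ℤ} {n : ℕ} {g : Fin n → σ} {c : ℤ} :
    NonnegFrom f c (List.ofFn g) ↔
      ∀ t ≤ n, 0 ≤ c + ∑ j ∈ Finset.univ.filter (fun j : Fin n => (j : ℕ) < t), f (g j) := by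
  simp only [nonnegFrom_iff_take, List.length_ofFn, List.map_take, List.map_ofFn,
    List.sum_take_ofFn, Function.comp_def]

theorem sum_map_ofFn {σ : Type*} {f : σ → ℤ} {n : ℕ} {g : Fin n → σ} :
    ((List.ofFn g).map f).sum =
      ∑ j ∈ Finset.univ.filter (fun j : Fin n => (j : ℕ) < n), f (g j) := by
  rw [List.map_ofFn, List.sum_ofFn, Finset.filter_true_of_mem fun j _ => j.2]
  rfl

open Classical in
theorem sum_indicator_eq_countBelow {n : ℕ} (B : Set (Fin n)) (t : ℕ) :
    ∑ j ∈ Finset.univ.filter (fun j : Fin n => (j : ℕ) < t), (if j ∈ B then 1 else 0 : ℤ) =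
      countBelow B t := by
  rw [Finset.sum_boole, Finset.filter_filter]
  rfl

theorem sum_rise_eq_northCount {n : ℕ} (w : Fin n → LatticeStep) (t : ℕ) :
    ∑ j ∈ Finset.univ.filter (fun j : Fin n => (j : ℕ) < t), (w j).rise = northCount w t := by
  classical
  rw [northCount_eq_countBelow, ← sum_indicator_eq_countBelow]
  refine Finset.sum_congr rfl fun j _ => ?_
  cases hj : w j <;> simp [hj, LatticeStep.rise]

namespace LatticePathPair

variable {m r : ℕ} (p : LatticePathPair m r)

theorem isBetween_iff_isBase {B : Set (Fin (m + r))} :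
    IsBetween B (List.ofFn fun i => (i, p.P i, p.Q i)) ↔ p.matroid.IsBase B := by
  simp only [IsBetween, IsExcursion, nonnegFrom_ofFn, sum_map_ofFn, lowerChange, upperChange,
    Finset.sum_sub_distrib, sum_indicator_eq_countBelow, sum_rise_eq_northCount, isBase_iff]
  have h1 := northCount_eq_card p.P
  have h2 := northCount_eq_card p.Q
  rw [p.card_P] at h1
  rw [p.card_Q] at h2
  constructor
  · rintro ⟨⟨h3, -⟩, h4, -⟩ t ht
    have := h3 t ht
    have := h4 t ht
    omega
  · intro h
    have h5 := h (m + r) le_rfl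
    refine ⟨⟨fun t ht => ?_, ?_⟩, fun t ht => ?_, ?_⟩
    · have := h t ht
      omega
    · omega
    · have := h t ht
      omega
    · omega

theorem isPathCode_of_isBase_image_iff {α : Type*} {M : Matroid α} {ψ : Fin (m + r) → α}
    (hψ : ψ.Injective) (hM : Set.range ψ = M.E)
    (h : ∀ B, M.IsBase (ψ '' B) ↔ p.matroid.IsBase B) :
    IsPathCode M (List.ofFn fun i => (ψ i, p.P i, p.Q i)) := by
  have hs : (List.ofFn fun i => (ψ i, p.P i, p.Q i)) =
      (List.ofFn fun i => (i, p.P i, p.Q i)).map (Prod.map ψ id) := by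
    rw [List.map_ofFn]
    rfl
  refine ⟨?_, fun e => ?_, fun B hB => ?_⟩
  · rw [List.map_ofFn, List.nodup_ofFn]
    exact hψ
  · rw [← hM]
    simp [List.mem_ofFn]
  · obtain ⟨B, rfl⟩ := Set.subset_range_iff_exists_image_eq.1 (hB.trans hM.ge)
    rw [h, hs, isBetween_image_map_iff hψ, isBetween_iff_isBase]

theorem northCount_le_of_branchWidth_le {α : Type*} {M : Matroid α} {ψ : Fin (m + r) → α}
    (hψ : ψ.Injective) (hM : Set.range ψ = M.E)
    (h : ∀ B, M.IsBase (ψ '' B) ↔ p.matroid.IsBase B) {k : ℕ} (hk : M.branchWidth ≤ k)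
    {t : ℕ} (ht : t ≤ m + r) : northCount p.Q t ≤ northCount p.P t + 2 * k := by
  have : M.Finite := ⟨hM ▸ Set.finite_range ψ⟩
  rcases Nat.eq_zero_or_pos (northCount p.Q t - northCount p.P t) with h0 | hpos
  · omega
  · obtain ⟨W, C, hW, hWC, hB⟩ := p.exists_uniform_window ht hpos (by omega)
    have hsub : ∀ X : Set (Fin (m + r)), ψ '' X ⊆ M.E := fun X =>
      (Set.image_subset_range _ _).trans hM.le
    have := Matroid.le_of_branchWidth_le (W := ψ '' W) (C := ψ '' C)
      (by rw [Set.ncard_image_of_injective _ hψ, hW]) (hsub W) (hsub C)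
      ((Set.disjoint_image_iff hψ).2 hWC) (fun S hS hSc => ?_) hk
    · omega
    · obtain ⟨S, hSW, rfl⟩ := Set.subset_image_iff.1 hS
      rw [Set.ncard_image_of_injective _ hψ] at hSc
      rw [← Set.image_union, h]
      exact hB S hSW hSc

end LatticePathPair

/-- A lattice path matroid of branch-width at most `k` is coded by a word of height at most
`2 k`. -/
theorem Matroid.IsLatticePathMatroid.exists_isPathCode {α : Type*} {M : Matroid α}
    (hM : M.IsLatticePathMatroid) {k : ℕ} (hk : M.branchWidth ≤ k) :
    ∃ s, IsPathCode M s ∧ s.map Prod.snd ∈ boundedExcursions gapChange (2 * k + 1) := by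
  obtain ⟨m, r, p, e, he⟩ := hM
  let ε : Fin (m + r) ≃ M.E := (Equiv.Set.univ _).symm.trans e.symm
  let ψ : Fin (m + r) → α := fun i => ε i
  have hψ : ψ.Injective := Subtype.val_injective.comp ε.injective
  have hψE : Set.range ψ = M.E := by
    rw [show ψ = Subtype.val ∘ ε from rfl, Set.range_comp, ε.range_eq_univ, Set.image_univ,
      Subtype.range_val]
  have hbase : ∀ B, M.IsBase (ψ '' B) ↔ p.matroid.IsBase B := by
    intro B
    have := Matroid.isBase_image_iff_of_indep_image_iff (N := p.matroid) (χ := id) hψ hψE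
      Function.injective_id (Set.range_id) (fun I => ?_) B
    · rwa [Set.image_id] at this
    · have h1 := he (ε '' I)
      rw [Set.image_image, Set.image_image, Set.image_image] at h1
      rw [show ψ '' I = (fun x => (ε x : α)) '' I from rfl, h1]
      have h2 : ∀ i, (e (ε i) : Fin (m + r)) = i := fun i =>
        congrArg Subtype.val (e.apply_symm_apply ((Equiv.Set.univ _).symm i))
      simp only [h2, Set.image_id', id]
  have hcode := p.isPathCode_of_isBase_image_iff hψ hψE hbase
  refine ⟨_, hcode, hcode.isExcursion_gapChange, ?_⟩
  rw [List.map_ofFn, nonnegFrom_ofFn]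
  intro t ht
  have h1 := p.northCount_le_of_branchWidth_le hψ hψE hbase hk ht
  simp only [Function.comp_apply, gapChange, Finset.sum_neg_distrib, Finset.sum_sub_distrib,
    sum_rise_eq_northCount]
  push_cast
  omega

theorem mainTheorem1 (k : ℕ) :
    IsPreorder (BoundedLatticePathMatroid.{u} k) BoundedLatticePathMatroid.Minor ∧
      WellQuasiOrdered (BoundedLatticePathMatroid.Minor.{u} (k := k)) := by
  refine ⟨{ refl := fun M => Matroid.IsIsoMinor.refl M.1.2
            trans := fun _ _ _ h h' => Matroid.IsIsoMinor.trans h h' }, fun M => ?_⟩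
  choose s hs hb using fun i => (M i).2.1.exists_isPathCode (M i).2.2
  obtain ⟨i, j, hij, hred⟩ := (partiallyWellOrderedOn_boundedExcursions abs_gapChange_le_one
    (2 * k + 1)).exists_lt (f := fun i => (s i).map Prod.snd) hb
  obtain ⟨M', s', hM', hs', hw⟩ := (hs j).exists_isMinor_of_excision hred
  exact ⟨i, j, hij, M', hM', (hs i).isIsomorphic hs' hw.symm⟩
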